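/- Let $G$ be a finite simple graph on $n$ vertices with $n \neq 3$ (that is, $G$ is not the triangle $K_3$) which is 2-connected (for every set $S$ of fewer than two vertices, $G - S$ is connected and nonempty) and outerplanar (it has a planar embedding with a face incident to all vertices). Then $$Z(G) \le \frac{n}{2}.$$ Here $Z(G)$, the zero forcing number of $G$, is the minimum size of a set of vertices which, when coloured blue while all other vertices are white, turns all vertices blue under repeated application of the rule: if a blue vertex has exactly one white neighbour, then that neighbour becomes blue. -/

import Mathlib

namespace OuterplanarZF

variable {V : Type*}

/-- `G` is `k`-connected if deleting any set of fewer than `k` vertices leaves a connected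
graph (connected graphs are nonempty). -/
def IsVertexConnected (G : SimpleGraph V) (k : ℕ) : Prop :=
  ∀ S : Finset V, S.card < k → (G.induce {v | v ∉ S}).Connected

/-- An embedding of a graph in an oriented closed surface, up to homeomorphism, given by its
rotation system: `rot` sends each dart (oriented edge) to the next dart around its initial
vertex, so the darts leaving a given vertex form exactly one cycle of `rot`. -/
structure RotationSystem (G : SimpleGraph V) where
  /-- the next dart in the cyclic order around the initial vertex -/
  rot : Equiv.Perm G.Dart
  /-- `rot` turns around a vertex -/
  rot_fst : ∀ d, (rot d).fst = d.fst
  /-- all darts leaving a vertex are met when turning around it -/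
  sameCycle_of_fst_eq : ∀ d e : G.Dart, d.fst = e.fst → rot.SameCycle d e

namespace RotationSystem

variable {G : SimpleGraph V} (R : RotationSystem G)

/-- Walking along the boundary of a face: traverse the dart `d`, then leave its end vertex
along the dart following the reversal of `d`. -/
def facePerm : Equiv.Perm G.Dart :=
  (Function.Involutive.toPerm SimpleGraph.Dart.symm SimpleGraph.Dart.symm_involutive).trans R.rot

/-- The faces: orbits of darts under the face-boundary walk. -/
def Face : Type _ := Quotient (Equiv.Perm.SameCycle.setoid R.facePerm)

/-- The face `f` is incident to the vertex `v`: its boundary walk passes through `v`. -/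
def Face.Incident {R : RotationSystem G} (f : R.Face) (v : V) : Prop :=
  ∃ d : G.Dart, d.fst = v ∧ Quotient.mk (Equiv.Perm.SameCycle.setoid R.facePerm) d = f

/-- The embedded surface is the sphere (equivalently, after removing a point of a face, the
plane), i.e. its Euler characteristic `|V| - |E| + |F|` is `2`. This is meant for connected
finite graphs with at least one edge, for which every face is a disk bounded by one closed
walk. -/
def IsPlanar : Prop :=
  Nat.card V + Nat.card R.Face = Nat.card G.edgeSet + 2

end RotationSystem

/-- A connected finite graph with at least one edge is outerplanar if it has a planar embedding
with a face, the outer face, that is incident to all vertices. -/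
def IsOuterplanar (G : SimpleGraph V) : Prop :=
  ∃ R : RotationSystem G, R.IsPlanar ∧ ∃ f : R.Face, ∀ v : V, f.Incident v

/-- One application of the colour change rule, where a colouring is given by its set of blue
vertices: a blue vertex `u` with exactly one white neighbour `v` turns `v` blue. -/
def ForceStep (G : SimpleGraph V) (B B' : Set V) : Prop :=
  ∃ u v : V, u ∈ B ∧ (∀ w, (G.Adj u w ∧ w ∉ B) ↔ w = v) ∧ B' = insert v B

/-- `B` is a zero forcing set: starting from `B`, repeated application of the colour change
rule turns all vertices blue. -/
def IsZeroForcingSet (G : SimpleGraph V) (B : Set V) : Prop :=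
  Relation.ReflTransGen (ForceStep G) B Set.univ

/-- The zero forcing number: the minimum size of a zero forcing set (in a finite graph the set
of all vertices is one). -/
noncomputable def zeroForcingNumber (G : SimpleGraph V) : ℕ :=
  sInf {k | ∃ B : Finset V, B.card = k ∧ IsZeroForcingSet G (B : Set V)}

end OuterplanarZF

/-! The outer face of a 2-connected outerplanar graph is bounded by a Hamilton cycle, and the
remaining edges are noncrossing chords. Both facts come from one mod 2 form of the Jordan curve
theorem, `exists_face_coloring`: Euler's formula forces every `ZMod 2`-cycle to be a boundary of
faces, so the faces can be 2-coloured with the colour changing exactly across the edges of the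
cycle. Applied to a cycle through a vertex, this shows that a face meets the vertex only once
(`eq_of_faceOf_eq`). Applied to a chord closed up along the outer face, it rules out crossings
(`noncrossing_of_fst_injOn`).

The bound is then proved by induction on such noncrossing Hamiltonian graphs. A chord of shortest
span cuts off a vertex `y` of degree two. Contracting the path `a y b` around it removes two
vertices and keeps the structure, and a zero forcing set of the contraction lifts at the cost of one
extra vertex (`IsPathContraction.exists_blue`). Noncrossing enters through the fact that `a` and `b`
have at most one common neighbour besides `y`. The base cases are `n = 2` and `n = 5`, the latter
because its contraction would have the excluded three vertices. -/

namespace OuterplanarZF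

variable {V : Type*} {G : SimpleGraph V}

/-! ### Faces of a plane graph and cycles modulo two. -/

namespace RotationSystem

variable (R : RotationSystem G)

/-- The face to which a dart belongs. -/
def faceOf (d : G.Dart) : R.Face :=
  Quotient.mk (Equiv.Perm.SameCycle.setoid R.facePerm) d

theorem faceOf_eq_iff {d e : G.Dart} :
    R.faceOf d = R.faceOf e ↔ R.facePerm.SameCycle d e :=
  Quotient.eq (r := Equiv.Perm.SameCycle.setoid R.facePerm)

theorem faceOf_surjective : Function.Surjective R.faceOf := fun f => Quotient.exists_rep f

theorem facePerm_apply (d : G.Dart) : R.facePerm d = R.rot d.symm := rfl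

theorem faceOf_symm (d : G.Dart) : R.faceOf d.symm = R.faceOf (R.rot d) := by
  rw [faceOf_eq_iff]
  refine ⟨1, ?_⟩
  simp [facePerm_apply]

/-- A function on darts invariant under `rot` is constant on the darts leaving a vertex. -/
theorem eq_of_fst_eq_of_rot {α : Type*} (g : G.Dart → α) (v : V)
    (hg : ∀ d : G.Dart, d.fst = v → g (R.rot d) = g d) {d e : G.Dart} (hd : d.fst = v)
    (he : e.fst = v) : g d = g e := by
  have key : ∀ (n : ℕ) (x : G.Dart), x.fst = v →
      ((R.rot ^ n) x).fst = v ∧ g ((R.rot ^ n) x) = g x := by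
    intro n
    induction n with
    | zero => intro x hx; simp [hx]
    | succ n ih =>
      intro x hx
      rw [pow_succ', Equiv.Perm.mul_apply]
      obtain ⟨h1, h2⟩ := ih x hx
      exact ⟨(R.rot_fst _).trans h1, (hg _ h1).trans h2⟩
  obtain ⟨k, hk⟩ := R.sameCycle_of_fst_eq d e (hd.trans he.symm)
  obtain ⟨n, rfl | rfl⟩ := k.eq_nat_or_neg
  · rw [zpow_natCast] at hk
    rw [← hk, (key n d hd).2]
  · rw [zpow_neg, zpow_natCast, Equiv.Perm.inv_eq_iff_eq] at hk
    rw [hk, (key n e he).2]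

instance [Finite V] : Finite R.Face :=
  have : Finite G.Dart := Finite.of_injective _ SimpleGraph.Dart.toProd_injective
  inferInstanceAs (Finite (Quotient _))

/-- A colouring of the faces which does not change across any edge is constant. -/
theorem face_const_of_symm (hconn : G.Connected) {α : Type*} (φ : R.Face → α)
    (h : ∀ d : G.Dart, φ (R.faceOf d) = φ (R.faceOf d.symm)) (f f' : R.Face) : φ f = φ f' := by
  -- `d.symm` and `rot d` lie on the same face, so invariance across edges is invariance under
  -- `rot`.
  have hv : ∀ d e : G.Dart, d.fst = e.fst → φ (R.faceOf d) = φ (R.faceOf e) := fun d e hde =>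
    R.eq_of_fst_eq_of_rot (fun d => φ (R.faceOf d)) e.fst
      (fun d _ => by rw [← faceOf_symm, ← h]) hde rfl
  have hw : ∀ u w : V, G.Walk u w → ∀ d e : G.Dart, d.fst = u → e.fst = w →
      φ (R.faceOf d) = φ (R.faceOf e) := by
    intro u w p
    induction p with
    | nil => intro d e hd he; exact hv d e (hd.trans he.symm)
    | @cons a b c hab p ih =>
      intro d e hd he
      rw [← ih (SimpleGraph.Dart.mk (a, b) hab).symm e rfl he, ← h]
      exact hv _ _ hd
  obtain ⟨d, rfl⟩ := R.faceOf_surjective f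
  obtain ⟨e, rfl⟩ := R.faceOf_surjective f'
  obtain ⟨p⟩ := hconn.preconnected d.fst e.fst
  exact hw _ _ p d e rfl rfl

theorem finrank_le_one_of_const {ι : Type*} [Finite ι] (S : Submodule (ZMod 2) (ι → ZMod 2))
    (h : ∀ g ∈ S, ∀ i j, g i = g j) : Module.finrank (ZMod 2) S ≤ 1 := by
  by_cases hi : Nonempty ι
  · obtain ⟨i⟩ := hi
    have hle : S ≤ Submodule.span (ZMod 2) {fun _ => 1} := fun g hg =>
      Submodule.mem_span_singleton.2 ⟨g i, funext fun j => by simp [h g hg i j]⟩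
    refine (Submodule.finrank_mono hle).trans ((finrank_span_le_card _).trans ?_)
    simp
  · have : IsEmpty ι := not_nonempty_iff.1 hi
    have : Subsingleton S := inferInstance
    simp [Module.finrank_zero_of_subsingleton]

open Classical in
/-- In a plane graph every cycle modulo two is the boundary of a set of faces. -/
theorem exists_face_coloring [Fintype V] (hconn : G.Connected) (hR : R.IsPlanar)
    (z : G.edgeSet → ZMod 2) (hz : ∀ v, ∑ e : G.edgeSet, (if v ∈ e.1 then z e else 0) = 0) :
    ∃ φ : R.Face → ZMod 2, ∀ d : G.Dart,
      φ (R.faceOf d) + φ (R.faceOf d.symm) = z ⟨d.edge, d.edge_mem⟩ := by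
  have := Fintype.ofFinite R.Face
  have hs : ∀ e : G.edgeSet, ∃ d : G.Dart, d.edge = e.1 := by
    rintro ⟨e, he⟩
    induction e with
    | _ a b => exact ⟨⟨(a, b), he⟩, rfl⟩
  choose s hs using hs
  -- The boundary map from faces to edges. It does not depend on the chosen darts `s e`, since it is
  -- symmetric under reversal.
  let δ : (R.Face → ZMod 2) →ₗ[ZMod 2] (G.edgeSet → ZMod 2) :=
    { toFun := fun φ e => φ (R.faceOf (s e)) + φ (R.faceOf (s e).symm)
      map_add' := fun φ ψ => by ext e; simp only [Pi.add_apply]; ring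
      map_smul' := fun c φ => by ext e; simp [mul_add] }
  have hδ : ∀ φ (d : G.Dart), δ φ ⟨d.edge, d.edge_mem⟩ =
      φ (R.faceOf d) + φ (R.faceOf d.symm) := by
    intro φ d
    have := hs ⟨d.edge, d.edge_mem⟩
    change φ (R.faceOf (s _)) + φ (R.faceOf (s _).symm) = _
    rcases SimpleGraph.dart_edge_eq_iff _ _ |>.1 this with h | h
    · rw [h]
    · rw [h, SimpleGraph.Dart.symm_symm, add_comm]
  let M : Matrix V G.edgeSet (ZMod 2) := Matrix.of fun v e => if v ∈ e.1 then 1 else 0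
  have hM : ∀ z v, M.mulVecLin z v = ∑ e : G.edgeSet, (if v ∈ e.1 then z e else 0) := by
    intro z v
    simp [M, Matrix.mulVec, dotProduct]
  have hMt : ∀ g (d : G.Dart), M.transpose.mulVecLin g ⟨d.edge, d.edge_mem⟩ =
      g d.fst + g d.snd := by
    intro g d
    have h1 : M.transpose.mulVecLin g ⟨d.edge, d.edge_mem⟩ =
        ∑ v ∈ ({d.fst, d.snd} : Finset V), g v := by
      simp only [M, Matrix.mulVecLin_apply, Matrix.mulVec, dotProduct, Matrix.transpose_apply,
        Matrix.of_apply, ite_mul, one_mul, zero_mul]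
      rw [← Finset.sum_filter]
      refine Finset.sum_congr ?_ fun _ _ => rfl
      ext v
      simp [SimpleGraph.Dart.edge]
    rw [h1, Finset.sum_pair d.fst_ne_snd]
  have h2 : ∀ x : ZMod 2, x + x = 0 := CharTwo.add_self_eq_zero
  have h2' : ∀ x y : ZMod 2, x + y = 0 → x = y := fun x y h => CharTwo.add_eq_zero.1 h
  -- Boundaries are cycles: around a vertex each face corner is counted twice, once for each of the
  -- two edges enclosing it.
  have hle : LinearMap.range δ ≤ LinearMap.ker M.mulVecLin := by
    rintro _ ⟨φ, rfl⟩
    rw [LinearMap.mem_ker]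
    ext v
    rw [hM]
    have : ∑ e : G.edgeSet, (if v ∈ e.1 then δ φ e else 0) =
        ∑ d : G.Dart, if d.fst = v then φ (R.faceOf d) + φ (R.faceOf (R.rot d)) else 0 := by
      rw [← Finset.sum_filter, ← Finset.sum_filter]
      symm
      refine Finset.sum_bij (fun d _ => ⟨d.edge, d.edge_mem⟩) ?_ ?_ ?_ ?_
      · intro d hd
        simp only [Finset.mem_filter, Finset.mem_univ, true_and] at hd ⊢
        subst hd
        exact Sym2.mem_mk_left _ _
      · intro d hd d' hd' h
        simp only [Finset.mem_filter, Finset.mem_univ, true_and] at hd hd'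
        rcases SimpleGraph.dart_edge_eq_iff _ _ |>.1 (Subtype.ext_iff.1 h) with h | h
        · exact h
        · exfalso
          rw [h] at hd
          exact d'.fst_ne_snd (hd'.trans hd.symm)
      · intro e he
        simp only [Finset.mem_filter, Finset.mem_univ, true_and] at he
        have hse := hs e
        rw [← hse] at he
        have : v = (s e).fst ∨ v = (s e).snd := Sym2.mem_iff.1 he
        rcases this with h | h
        · exact ⟨s e, by simp [h], Subtype.ext hse⟩
        · exact ⟨(s e).symm, by simp [h], Subtype.ext (by simpa using hse)⟩
      · intro d _
        rw [hδ, faceOf_symm]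
    rw [this]
    have h3 : ∑ d : G.Dart, (if d.fst = v then φ (R.faceOf (R.rot d)) else 0) =
        ∑ d : G.Dart, (if d.fst = v then φ (R.faceOf d) else 0) := by
      rw [← Equiv.sum_comp R.rot (fun d => if d.fst = v then φ (R.faceOf d) else 0)]
      simp only [R.rot_fst]
    have h4 : ∀ d : G.Dart,
        (if d.fst = v then φ (R.faceOf d) + φ (R.faceOf (R.rot d)) else 0) =
        (if d.fst = v then φ (R.faceOf d) else 0) +
          (if d.fst = v then φ (R.faceOf (R.rot d)) else 0) := by
      intro d
      split_ifs <;> simp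
    simp only [h4, Finset.sum_add_distrib, h3, h2, Pi.zero_apply]
  have hkδ : Module.finrank (ZMod 2) (LinearMap.ker δ) ≤ 1 := by
    refine finrank_le_one_of_const _ fun φ hφ => R.face_const_of_symm hconn φ fun d => h2' _ _ ?_
    rw [← hδ, LinearMap.mem_ker.1 hφ]
    rfl
  have hkM : Module.finrank (ZMod 2) (LinearMap.ker M.transpose.mulVecLin) ≤ 1 := by
    refine finrank_le_one_of_const _ fun g hg u w => ?_
    obtain ⟨p⟩ := hconn.preconnected u w
    induction p with
    | nil => rfl
    | @cons a b c hab p ih =>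
      rw [← ih]
      refine h2' _ _ ?_
      rw [← hMt g ⟨(a, b), hab⟩, LinearMap.mem_ker.1 hg]
      rfl
  have e1 := LinearMap.finrank_range_add_finrank_ker δ
  have e2 := LinearMap.finrank_range_add_finrank_ker M.mulVecLin
  have e3 := LinearMap.finrank_range_add_finrank_ker M.transpose.mulVecLin
  have e4 : Module.finrank (ZMod 2) (LinearMap.range M.transpose.mulVecLin) =
      Module.finrank (ZMod 2) (LinearMap.range M.mulVecLin) := M.rank_transpose
  have e5 := hR
  unfold IsPlanar at e5
  rw [Nat.card_eq_fintype_card, Nat.card_eq_fintype_card, Nat.card_eq_fintype_card] at e5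
  rw [Module.finrank_fintype_fun_eq_card] at e1 e2 e3
  -- By connectedness the rank of `δ` is at least `F - 1` and that of `M` at least `V - 1`, so by
  -- Euler's formula the cycle space has dimension at most `E - V + 1 = F - 1`.
  have heq := Submodule.eq_of_le_of_finrank_le hle (by omega)
  have hzm : z ∈ LinearMap.range δ := by
    rw [heq, LinearMap.mem_ker]
    ext v
    rw [hM, hz]
    rfl
  obtain ⟨φ, rfl⟩ := hzm
  exact ⟨φ, fun d => (hδ φ d).symm⟩

end RotationSystem
end OuterplanarZF

/-! ### Lifting zero forcing sets along the contraction of a path. -/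

namespace OuterplanarZF

/-- The vertices that turn blue when starting from the blue set `B`. -/
inductive Blue {V : Type*} (G : SimpleGraph V) (B : Set V) : V → Prop
  | init {x : V} : x ∈ B → Blue G B x
  | force {u x : V} : Blue G B u → G.Adj u x → (∀ w, G.Adj u w → w ≠ x → Blue G B w) → Blue G B x

variable {V V' : Type*} {G : SimpleGraph V} {G' : SimpleGraph V'}

/-- The order of the forces is irrelevant: a set containing `B` in which no force is possible is
closed under the rules of `Blue`, hence is everything. -/
theorem isZeroForcingSet_of_blue [Finite V] {B : Set V} (h : ∀ x, Blue G B x) :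
    IsZeroForcingSet G B := by
  have step : ∀ C : Set V, B ⊆ C → C ≠ Set.univ → ∃ x ∉ C, ForceStep G C (insert x C) := by
    intro C hBC hC
    by_contra! hno
    refine hC (Set.eq_univ_of_forall fun x => ?_)
    induction h x with
    | init hx => exact hBC hx
    | @force u x _ hux _ hu hw =>
      by_contra hx
      refine hno x hx ⟨u, x, hu, fun w => ⟨fun ⟨h1, h2⟩ => ?_, ?_⟩, rfl⟩
      · by_contra hwx
        exact h2 (hw w h1 hwx)
      · rintro rfl
        exact ⟨hux, hx⟩
  have main : ∀ (k : ℕ) (C : Set V), B ⊆ C → (Cᶜ).ncard = k →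
      Relation.ReflTransGen (ForceStep G) C Set.univ := by
    intro k
    induction k with
    | zero =>
      intro C _ hk
      rw [Set.ncard_eq_zero, Set.compl_empty_iff] at hk
      rw [hk]
    | succ k ih =>
      intro C hBC hk
      have hC : C ≠ Set.univ := by
        rintro rfl
        simp at hk
      obtain ⟨x, hx, hs⟩ := step C hBC hC
      refine Relation.ReflTransGen.head hs (ih _ (hBC.trans (Set.subset_insert _ _)) ?_)
      have : (insert x C)ᶜ = Cᶜ \ {x} := by
        ext y; simp [and_comm]
      rw [this, Set.ncard_sdiff_singleton_of_mem hx, hk]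
      rfl
  exact main _ B subset_rfl rfl

theorem zeroForcingNumber_le [Finite V] (B : Finset V) (h : ∀ x, Blue G (B : Set V) x) :
    zeroForcingNumber G ≤ B.card :=
  Nat.sInf_le ⟨B, rfl, isZeroForcingSet_of_blue h⟩

theorem Blue.map_equiv (e : V ≃ V') (he : ∀ x y, G'.Adj (e x) (e y) ↔ G.Adj x y) {B : Set V}
    {x : V} (h : Blue G B x) : Blue G' (e '' B) (e x) := by
  induction h with
  | init hx => exact .init ⟨_, hx, rfl⟩
  | @force u x _ hux _ hu hw =>
    refine .force hu ((he _ _).2 hux) fun w hw1 hw2 => ?_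
    obtain ⟨w, rfl⟩ := e.surjective w
    exact hw w ((he _ _).1 hw1) fun h => hw2 (h ▸ rfl)

/-- A vertex which turns blue either is blue at the beginning or is forced at some step. -/
theorem exists_forceStep_of_notMem {B C : Set V} (h : Relation.ReflTransGen (ForceStep G) B C)
    {v : V} (hB : v ∉ B) (hC : v ∈ C) : ∃ D u, Relation.ReflTransGen (ForceStep G) B D ∧ v ∉ D ∧
      u ∈ D ∧ (∀ w, (G.Adj u w ∧ w ∉ D) ↔ w = v) ∧
      Relation.ReflTransGen (ForceStep G) (insert v D) C := by
  induction h using Relation.ReflTransGen.head_induction_on with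
  | refl => exact absurd hC hB
  | @head B B' hs ht ih =>
    by_cases hv : v ∈ B'
    · obtain ⟨u, x, hu, hx, rfl⟩ := hs
      have : v = x := hv.resolve_right hB
      subst this
      exact ⟨B, u, .refl, hB, hu, hx, ht⟩
    · obtain ⟨D, u, h1, h2⟩ := ih hv
      exact ⟨D, u, h1.head hs, h2⟩

theorem subset_of_reflTransGen {B C : Set V} (h : Relation.ReflTransGen (ForceStep G) B C) :
    B ⊆ C := by
  induction h with
  | refl => rfl
  | tail _ hs ih =>
    obtain ⟨u, x, -, -, rfl⟩ := hs
    exact ih.trans (Set.subset_insert _ _)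

/-- `p` contracts the path `a y b` of `G`, whose inner vertex `y` has degree two and whose ends
have at most one further common neighbour, to a vertex of `G'`. -/
structure IsPathContraction (G : SimpleGraph V) (G' : SimpleGraph V') (p : V → V') (a y b : V) :
    Prop where
  surj : Function.Surjective p
  map_y : p y = p a
  map_b : p b = p a
  inj : ∀ x x', p x = p x' → p x ≠ p a → x = x'
  fiber : ∀ x, p x = p a → x = a ∨ x = y ∨ x = b
  adj_map : ∀ x x', G.Adj x x' → p x ≠ p x' → G'.Adj (p x) (p x')
  exists_adj : ∀ u u', G'.Adj u u' → ∃ x x', p x = u ∧ p x' = u' ∧ G.Adj x x'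
  adj_y : ∀ x, G.Adj y x ↔ x = a ∨ x = b
  ne : a ≠ b
  common : ∀ x x', G.Adj a x → G.Adj b x → G.Adj a x' → G.Adj b x' → x ≠ y → x' ≠ y → x = x'

namespace IsPathContraction

variable {p : V → V'} {a y b : V}

theorem symm (hp : IsPathContraction G G' p a y b) : IsPathContraction G G' p b y a where
  surj := hp.surj
  map_y := by rw [hp.map_y, hp.map_b]
  map_b := hp.map_b.symm
  inj := by rw [hp.map_b]; exact hp.inj
  fiber := by rw [hp.map_b]; intro x hx; have := hp.fiber x hx; tauto
  adj_map := hp.adj_map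
  exists_adj := hp.exists_adj
  adj_y := fun x => by rw [hp.adj_y, or_comm]
  ne := hp.ne.symm
  common := fun x x' h1 h2 h3 h4 => hp.common x x' h2 h1 h4 h3

/-- A force in `G'` between vertices outside the contracted path lifts to `G`. -/
theorem blue_of_force (hp : IsPathContraction G G' p a y b) {B : Set V} {C : Set V'} {u z : V'}
    (hC : ∀ x, p x ∈ C → x ≠ y → Blue G B x) (hu : u ∈ C) (hua : u ≠ p a) (hza : z ≠ p a)
    (hz : ∀ w, (G'.Adj u w ∧ w ∉ C) ↔ w = z) {x : V} (hx : p x = z) : Blue G B x := by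
  obtain ⟨x₀, x', h0, h1, h2⟩ := hp.exists_adj u z ((hz z).2 rfl).1
  have : x' = x := hp.inj _ _ (h1.trans hx.symm) (by rw [h1]; exact hza)
  subst this
  have hy : ∀ w, p w ≠ p a → w ≠ y := by
    rintro w hw rfl
    exact hw hp.map_y
  refine .force (hC x₀ (h0 ▸ hu) (hy _ (h0 ▸ hua))) h2 fun w hw hwx => ?_
  have hne : p x₀ ≠ p w := fun h => hw.ne (hp.inj _ _ h (h0 ▸ hua))
  refine hC w ?_ ?_
  · by_contra hwC
    refine hwx (hp.inj _ _ ?_ ?_)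
    · rw [hx]
      exact (hz _).1 ⟨h0 ▸ hp.adj_map _ _ hw hne, hwC⟩
    · rw [(hz _).1 ⟨h0 ▸ hp.adj_map _ _ hw hne, hwC⟩]
      exact hza
  · rintro rfl
    rcases (hp.adj_y x₀).1 hw.symm with rfl | rfl
    · exact hua h0.symm
    · exact hua (h0.symm.trans hp.map_b)

/-- After the contracted path has been coloured, with the possible exception of its inner vertex,
the colouring of `G` follows that of `G'`. -/
theorem blue_of_mem (hp : IsPathContraction G G' p a y b) {B : Set V} {C D : Set V'}
    (hC : ∀ x, p x ∈ C → x ≠ y → Blue G B x) (ha : p a ∈ C)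
    (hcommon : Blue G B y ∨ ∃ c, p c ∈ C ∧ c ≠ y ∧ G.Adj a c ∧ G.Adj b c)
    (h : Relation.ReflTransGen (ForceStep G') C D) : ∀ x, p x ∈ D → x ≠ y → Blue G B x := by
  induction h with
  | refl => exact hC
  | @tail D D' hCD hs ih =>
    have hCD := subset_of_reflTransGen hCD
    obtain ⟨u, z, hu, hz, rfl⟩ := hs
    rintro x (hx | hx) hxy
    swap
    · exact ih x hx hxy
    have hzD : z ∉ D := ((hz z).2 rfl).2
    have hza : z ≠ p a := by
      rintro rfl
      exact hzD (hCD ha)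
    by_cases hua : u = p a
    swap
    · exact hp.blue_of_force ih hu hua hza hz hx
    subst hua
    obtain ⟨x₀, x', h0, h1, h2⟩ := hp.exists_adj _ z ((hz z).2 rfl).1
    have hx' : x' = x := hp.inj _ _ (h1.trans hx.symm) (by rw [h1]; exact hza)
    subst hx'
    have hna : x' ≠ a := by rintro rfl; exact hza h1.symm
    have hnb : x' ≠ b := by rintro rfl; exact hza (h1.symm.trans hp.map_b)
    have hay : a ≠ y := ((hp.adj_y a).2 (Or.inl rfl)).ne'
    have hby : b ≠ y := ((hp.adj_y b).2 (Or.inr rfl)).ne'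
    have nb : ∀ v w, p v = p a → G.Adj v w → w ≠ x' → w ≠ y → Blue G B w := by
      intro v w hv hvw hwx hwy
      refine ih w ?_ hwy
      by_contra hwD
      have hne : p v ≠ p w := by
        intro h
        rw [← h, hv] at hwD
        exact hwD (hCD ha)
      have hpw : p w = z := (hz _).1 ⟨hv ▸ hp.adj_map _ _ hvw hne, hwD⟩
      exact hwx (hp.inj _ _ (hpw.trans h1.symm) (hpw ▸ hza))
    have hA : Blue G B a := ih a (hCD ha) hay
    have hB : Blue G B b := ih b (hp.map_b ▸ hCD ha) hby
    -- If `y` may still be white, the one common neighbour allowed besides `y` is the coloured `c`,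
    -- so the vertex `x'` being forced sees only one of `a`, `b`. The other one can first force `y`.
    have notboth : Blue G B y ∨ ¬ (G.Adj a x' ∧ G.Adj b x') := by
      rcases hcommon with h | ⟨c, hc, hcy, hac, hbc⟩
      · exact Or.inl h
      · refine Or.inr fun ⟨h3, h4⟩ => hzD ?_
        rw [← h1, hp.common x' c h3 h4 hac hbc hxy hcy]
        exact hCD hc
    rcases hp.fiber _ h0 with rfl | rfl | rfl
    · have hY : Blue G B y := by
        rcases notboth with h | h
        · exact h
        · refine .force hB ((hp.adj_y b).2 (Or.inr rfl)).symm fun w hbw hwy => ?_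
          refine nb b w hp.map_b hbw ?_ hwy
          rintro rfl
          exact h ⟨h2, hbw⟩
      refine .force hA h2 fun w hw hwx => ?_
      by_cases hwy : w = y
      · rw [hwy]; exact hY
      · exact nb _ w rfl hw hwx hwy
    · exact absurd ((hp.adj_y x').1 h2) (by tauto)
    · have hY : Blue G B y := by
        rcases notboth with h | h
        · exact h
        · refine .force hA ((hp.adj_y a).2 (Or.inl rfl)).symm fun w hbw hwy => ?_
          refine nb a w rfl hbw ?_ hwy
          rintro rfl
          exact h ⟨hbw, h2⟩
      refine .force hB h2 fun w hw hwx => ?_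
      by_cases hwy : w = y
      · rw [hwy]; exact hY
      · exact nb _ w hp.map_b hw hwx hwy

/-- If all vertices other than the inner vertex of the path are coloured, so is that vertex. -/
theorem blue_of_forall_ne (hp : IsPathContraction G G' p a y b) {B : Set V}
    (h : ∀ x, x ≠ y → Blue G B x) (x : V) : Blue G B x := by
  by_cases hx : x = y
  · subst hx
    have := (hp.adj_y a).2 (Or.inl rfl)
    exact .force (h a this.ne') this.symm fun w _ hw => h w hw
  · exact h x hx

/-- As long as the contracted vertex is white, the colouring of `G` follows that of `G'`. -/
theorem blue_of_notMem (hp : IsPathContraction G G' p a y b) {B : Set V} {C D : Set V'}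
    (hC : ∀ x, p x ∈ C → x ≠ y → Blue G B x)
    (h : Relation.ReflTransGen (ForceStep G') C D) (ha : p a ∉ D) :
    ∀ x, p x ∈ D → x ≠ y → Blue G B x := by
  induction h with
  | refl => exact hC
  | @tail D D' hCD hs ih =>
    obtain ⟨u, z, hu, hz, rfl⟩ := hs
    rw [Set.mem_insert_iff, not_or] at ha
    have ih := ih ha.2
    rintro x (hx | hx) hxy
    · exact hp.blue_of_force ih hu (fun h => ha.2 (h ▸ hu)) (Ne.symm ha.1) hz hx
    · exact ih x hx hxy

/-- The case where the contracted vertex is forced by a vertex adjacent to `a` only. -/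
theorem forall_blue_of_not_adj (hp : IsPathContraction G G' p a y b) {B : Set V} {D : Set V'}
    {x₀ : V} (hD : ∀ x, p x ∈ D → x ≠ y → Blue G B x) (hy : y ∈ B)
    (haD : p a ∉ D) (h0 : p x₀ ∈ D) (hz : ∀ w, (G'.Adj (p x₀) w ∧ w ∉ D) ↔ w = p a)
    (hax : G.Adj x₀ a) (hbx : ¬ G.Adj x₀ b)
    (h : Relation.ReflTransGen (ForceStep G') (insert (p a) D) Set.univ) (x : V) :
    Blue G B x := by
  have h0y : x₀ ≠ y := by
    rintro rfl
    exact haD (hp.map_y ▸ h0)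
  have hA : Blue G B a := by
    refine .force (hD _ h0 h0y) hax fun w hw hwa => ?_
    have hwy : w ≠ y := by
      rintro rfl
      rcases (hp.adj_y x₀).1 hw.symm with rfl | rfl
      · exact haD h0
      · exact haD (hp.map_b ▸ h0)
    refine hD w ?_ hwy
    by_contra hwD
    have hne : p x₀ ≠ p w := fun h => hwD (h ▸ h0)
    rcases hp.fiber w ((hz _).1 ⟨hp.adj_map _ _ hw hne, hwD⟩) with rfl | rfl | rfl
    · exact hwa rfl
    · exact hwy rfl
    · exact hbx hw
  have hB : Blue G B b := by
    refine .force (.init hy) ((hp.adj_y b).2 (Or.inr rfl)) fun w hw hwb => ?_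
    rcases (hp.adj_y w).1 hw with rfl | rfl
    · exact hA
    · exact absurd rfl hwb
  refine hp.blue_of_forall_ne (fun x => hp.blue_of_mem ?_ (Set.mem_insert _ _)
    (Or.inl (.init hy)) h x (Set.mem_univ _)) x
  rintro x (hx | hx) hxy
  · rcases hp.fiber x hx with rfl | rfl | rfl
    · exact hA
    · exact absurd rfl hxy
    · exact hB
  · exact hD x hx hxy

-- Lift the vertices of `B'` and spend one extra vertex on the path, chosen according to how the
-- contracted vertex becomes blue in `G'`.
open Classical in
theorem exists_blue (hp : IsPathContraction G G' p a y b) (B' : Finset V')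
    (h : IsZeroForcingSet G' (B' : Set V')) :
    ∃ B : Finset V, B.card ≤ B'.card + 1 ∧ ∀ x, Blue G (B : Set V) x := by
  let s : V' → V := Function.surjInv hp.surj
  have hs : ∀ v, p (s v) = v := Function.surjInv_eq hp.surj
  have hcard : ∀ x, (insert x (B'.image s)).card ≤ B'.card + 1 := fun x =>
    (Finset.card_insert_le _ _).trans (Nat.add_le_add_right Finset.card_image_le 1)
  have hinit : ∀ x₀ x, p x ∈ (B' : Set V') → p x ≠ p a →
      Blue G (insert x₀ (B'.image s) : Finset V) x := by
    intro x₀ x hx hxa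
    have : x = s (p x) := hp.inj _ _ (hs _).symm hxa
    refine .init ?_
    rw [Finset.mem_coe, Finset.mem_insert, Finset.mem_image]
    exact Or.inr ⟨p x, hx, this.symm⟩
  by_cases ha : p a ∈ (B' : Set V')
  -- The contracted vertex is blue initially: replace it by `a` and `y`, and `y` forces `b`.
  · refine ⟨insert y (insert a ((B'.erase (p a)).image s)), ?_, ?_⟩
    · have h1 := Finset.card_insert_le y (insert a ((B'.erase (p a)).image s))
      have h2 := Finset.card_insert_le a ((B'.erase (p a)).image s)
      have h3 : ((B'.erase (p a)).image s).card ≤ _ := Finset.card_image_le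
      have h4 := Finset.card_erase_add_one (Finset.mem_coe.1 ha)
      omega
    · have hA : Blue G ((insert y (insert a ((B'.erase (p a)).image s)) : Finset V) : Set V) a :=
        .init (by simp)
      have hY : Blue G ((insert y (insert a ((B'.erase (p a)).image s)) : Finset V) : Set V) y :=
        .init (by simp)
      have hB : Blue G ((insert y (insert a ((B'.erase (p a)).image s)) : Finset V) : Set V) b := by
        refine .force hY ((hp.adj_y b).2 (Or.inr rfl)) fun w hw hwb => ?_
        rcases (hp.adj_y w).1 hw with rfl | rfl
        · exact hA
        · exact absurd rfl hwb
      refine hp.blue_of_forall_ne fun x => hp.blue_of_mem ?_ ha (Or.inl hY) h x (Set.mem_univ _)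
      intro x hx hxy
      by_cases hxa : p x = p a
      · rcases hp.fiber x hxa with rfl | rfl | rfl
        · exact hA
        · exact absurd rfl hxy
        · exact hB
      · have : x = s (p x) := hp.inj _ _ (hs _).symm hxa
        refine .init ?_
        simp only [Finset.mem_coe, Finset.mem_insert, Finset.mem_image, Finset.mem_erase]
        exact Or.inr (Or.inr ⟨p x, ⟨hxa, hx⟩, this.symm⟩)
  · obtain ⟨D, u, hBD, haD, huD, hz, hDu⟩ := exists_forceStep_of_notMem h ha (Set.mem_univ _)
    obtain ⟨x₀, x', rfl, h1, h2⟩ := hp.exists_adj _ _ ((hz _).2 rfl).1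
    have hD : ∀ x₁ x, p x ∈ D → x ≠ y → Blue G (insert x₁ (B'.image s) : Finset V) x := fun x₁ =>
      hp.blue_of_notMem
        (fun x hx _ => hinit x₁ x hx fun hxa => ha (hxa ▸ hx)) hBD haD
    have hx'y : x' ≠ y := by
      rintro rfl
      rcases (hp.adj_y x₀).1 h2.symm with rfl | rfl
      · exact haD huD
      · exact haD (hp.map_b ▸ huD)
    by_cases hb : G.Adj x₀ b
    · by_cases ha' : G.Adj x₀ a
      -- The forcing vertex `x₀` sees both ends: with `a` added it forces `b`, and it is itself the
      -- blue common neighbour, so `y` may stay white.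
      · refine ⟨_, hcard a, hp.blue_of_forall_ne fun x => hp.blue_of_mem (fun x hx hxy => ?_)
          (Set.mem_insert _ _) (Or.inr ⟨x₀, Or.inr huD, ?_, ha'.symm, hb.symm⟩) hDu x
          (Set.mem_univ _)⟩
        · rcases hx with hx | hx
          swap
          · exact hD a x hx hxy
          have hA : Blue G (insert a (B'.image s) : Finset V) a := .init (by simp)
          rcases hp.fiber x hx with rfl | rfl | rfl
          · exact hA
          · exact absurd rfl hxy
          · refine .force (hD a x₀ huD ?_) hb fun w hw hwx => ?_
            · rintro rfl
              exact haD (hp.map_y ▸ huD)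
            have hwy : w ≠ y := by
              rintro rfl
              rcases (hp.adj_y x₀).1 hw.symm with rfl | rfl
              · exact haD huD
              · exact haD (hp.map_b ▸ huD)
            by_cases hwD : p w ∈ D
            · exact hD a w hwD hwy
            · have hne : p x₀ ≠ p w := fun h => hwD (h ▸ huD)
              rcases hp.fiber w ((hz _).1 ⟨hp.adj_map _ _ hw hne, hwD⟩) with rfl | rfl | rfl
              · exact hA
              · exact absurd rfl hwy
              · exact absurd rfl hwx
        · rintro rfl
          exact haD (hp.map_y ▸ huD)
      -- Only one end is seen by `x₀`: it forces that end, and the added vertex `y` forces the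
      -- other.
      · refine ⟨_, hcard y, hp.symm.forall_blue_of_not_adj (D := D) (x₀ := x₀) (hD y) (by simp) ?_
          huD ?_ hb ha' ?_⟩
        · rwa [hp.map_b]
        · rwa [hp.map_b]
        · rwa [hp.map_b]
    · have ha' : G.Adj x₀ a := by
        rcases hp.fiber x' h1 with rfl | rfl | rfl
        · exact h2
        · exact absurd rfl hx'y
        · exact absurd h2 hb
      exact ⟨_, hcard y, hp.forall_blue_of_not_adj (D := D) (x₀ := x₀) (hD y) (by simp) haD
        huD hz ha' hb hDu⟩

end IsPathContraction
end OuterplanarZF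

/-! ### Induction on noncrossing Hamiltonian graphs. -/

namespace OuterplanarZF

/-- A graph on `0, …, n - 1` containing the cycle through these numbers in order, all of whose
edges are noncrossing when the numbers are placed on a circle. -/
structure IsNoncrossingHamiltonian {n : ℕ} (G : SimpleGraph (Fin n)) : Prop where
  adj_succ : ∀ i j : Fin n, i.val + 1 = j.val → G.Adj i j
  adj_last : ∀ i j : Fin n, i.val = 0 → j.val + 1 = n → G.Adj i j
  noncrossing : ∀ i j k l : Fin n, i < j → j < k → k < l → G.Adj i k → ¬ G.Adj j l

namespace IsNoncrossingHamiltonian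

/-- The monotone map contracting `i`, `i + 1`, `i + 2` to `i`. -/
def collapse {n : ℕ} (i : ℕ) (hi : i + 2 < n + 2) (x : Fin (n + 2)) : Fin n :=
  ⟨if x.val ≤ i then x.val else if x.val ≤ i + 2 then i else x.val - 2, by
    have := x.2; split_ifs <;> omega⟩

/-- The graph obtained by contracting `i`, `i + 1`, `i + 2`. -/
def contract {n : ℕ} (G : SimpleGraph (Fin (n + 2))) (i : ℕ) (hi : i + 2 < n + 2) :
    SimpleGraph (Fin n) :=
  SimpleGraph.fromRel fun u w => ∃ x y, collapse i hi x = u ∧ collapse i hi y = w ∧ G.Adj x y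

theorem contract_adj {n : ℕ} {G : SimpleGraph (Fin (n + 2))} {i : ℕ} {hi : i + 2 < n + 2}
    {u w : Fin n} : (contract G i hi).Adj u w ↔
      u ≠ w ∧ ∃ x y, collapse i hi x = u ∧ collapse i hi y = w ∧ G.Adj x y := by
  rw [contract, SimpleGraph.fromRel_adj]
  refine and_congr_right fun _ => ⟨?_, Or.inl⟩
  rintro (h | ⟨x, y, hx, hy, h⟩)
  · exact h
  · exact ⟨y, x, hy, hx, h.symm⟩

theorem collapse_lt {n : ℕ} {i : ℕ} {hi : i + 2 < n + 2} {x y : Fin (n + 2)}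
    (h : collapse i hi x < collapse i hi y) : x < y := by
  rw [Fin.lt_def] at *
  simp only [collapse] at h
  split_ifs at h <;> omega

/-- Since `collapse` is monotone, crossing edges of the contraction would lift to crossing edges of
`G`. -/
theorem contract_isNoncrossingHamiltonian {n : ℕ} {G : SimpleGraph (Fin (n + 2))}
    (h : IsNoncrossingHamiltonian G) (hn : 2 ≤ n) (i : ℕ) (hi : i + 2 < n + 2) :
    IsNoncrossingHamiltonian (contract G i hi) where
  adj_succ := by
    intro u w huw
    rw [contract_adj]
    refine ⟨by rintro rfl; omega, ?_⟩
    have := w.2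
    rcases lt_or_ge u.val i with hu | hu
    · refine ⟨⟨u.val, by omega⟩, ⟨w.val, by omega⟩, ?_, ?_, h.adj_succ _ _ huw⟩ <;>
      · ext
        simp only [collapse]
        split_ifs <;> omega
    · refine ⟨⟨u.val + 2, by omega⟩, ⟨w.val + 2, by omega⟩, ?_, ?_,
        h.adj_succ _ _ (by simp only; omega)⟩ <;>
      · ext
        simp only [collapse]
        split_ifs <;> omega
  adj_last := by
    intro u w hu hw
    rw [contract_adj]
    refine ⟨by rintro rfl; omega, ⟨0, by omega⟩, ⟨n + 1, by omega⟩, ?_, ?_,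
      h.adj_last _ _ rfl rfl⟩ <;>
    · ext
      simp only [collapse]
      split_ifs <;> omega
  noncrossing := by
    intro i j k l hij hjk hkl hik hjl
    rw [contract_adj] at hik hjl
    obtain ⟨-, x, z, rfl, rfl, hxz⟩ := hik
    obtain ⟨-, y, t, rfl, rfl, hyt⟩ := hjl
    exact h.noncrossing _ _ _ _ (collapse_lt hij) (collapse_lt hjk) (collapse_lt hkl) hxz hyt

theorem isPathContraction {n : ℕ} {G : SimpleGraph (Fin (n + 2))}
    (h : IsNoncrossingHamiltonian G) {i : ℕ} (hi : i + 2 < n + 2)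
    (hdeg : ∀ x, G.Adj ⟨i + 1, by omega⟩ x → x.val = i ∨ x.val = i + 2) :
    IsPathContraction G (contract G i hi) (collapse i hi) ⟨i, by omega⟩ ⟨i + 1, by omega⟩
      ⟨i + 2, hi⟩ where
  surj := by
    intro u
    have := u.2
    by_cases hu : u.val ≤ i
    · refine ⟨⟨u.val, by omega⟩, ?_⟩
      ext
      simp only [collapse]
      split_ifs; omega
    · refine ⟨⟨u.val + 2, by omega⟩, ?_⟩
      ext
      simp only [collapse]
      split_ifs <;> omega
  map_y := by
    ext
    simp only [collapse]
    split_ifs <;> omega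
  map_b := by
    ext
    simp only [collapse]
    split_ifs <;> omega
  inj := by
    intro x x' hx hxa
    rw [Ne, Fin.ext_iff] at hxa
    rw [Fin.ext_iff] at hx ⊢
    simp only [collapse] at hx hxa
    split_ifs at hx hxa <;> omega
  fiber := by
    intro x hx
    simp only [Fin.ext_iff, collapse] at hx ⊢
    split_ifs at hx <;> omega
  adj_map := fun x x' hx hne => contract_adj.2 ⟨hne, x, x', rfl, rfl, hx⟩
  exists_adj := fun u u' hu => (contract_adj.1 hu).2
  adj_y := by
    intro x
    refine ⟨fun hx => ?_, ?_⟩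
    · rw [Fin.ext_iff, Fin.ext_iff]
      exact hdeg x hx
    · rintro (rfl | rfl)
      · exact (h.adj_succ _ _ rfl).symm
      · exact h.adj_succ _ _ rfl
  ne := by
    rw [Ne, Fin.ext_iff]
    simp
  common := by
    -- Wherever two common neighbours lie relative to the path, an edge from `i` to one crosses an
    -- edge from `i + 2` to the other.
    have key : ∀ x x' : Fin (n + 2), x < x' → G.Adj ⟨i, by omega⟩ x → G.Adj ⟨i + 2, hi⟩ x →
        G.Adj ⟨i, by omega⟩ x' → G.Adj ⟨i + 2, hi⟩ x' → x ≠ ⟨i + 1, by omega⟩ →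
        x' ≠ ⟨i + 1, by omega⟩ → False := by
      intro x x' hlt h1 h2 h3 h4 h5 h6
      have e1 := h1.ne
      have e2 := h2.ne
      have e3 := h3.ne
      have e4 := h4.ne
      simp only [Ne, Fin.ext_iff] at e1 e2 e3 e4 h5 h6
      rw [Fin.lt_def] at hlt
      by_cases hx : i < x.val
      · refine h.noncrossing _ _ _ _ ?_ ?_ hlt h1 h4 <;> simp only [Fin.lt_def] <;> omega
      · by_cases hx' : i < x'.val
        · refine h.noncrossing _ _ _ _ ?_ ?_ ?_ h2.symm h3 <;> simp only [Fin.lt_def] <;> omega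
        · refine h.noncrossing _ _ _ _ hlt ?_ ?_ h1.symm h4.symm <;>
            simp only [Fin.lt_def] <;> omega
    intro x x' h1 h2 h3 h4 h5 h6
    rcases lt_trichotomy x x' with hlt | he | hlt
    · exact (key x x' hlt h1 h2 h3 h4 h5 h6).elim
    · exact he
    · exact (key x' x hlt h3 h4 h1 h2 h6 h5).elim

/-- There is a vertex of degree two. -/
theorem exists_degree_two {n : ℕ} {G : SimpleGraph (Fin n)} (h : IsNoncrossingHamiltonian G)
    (hn : 3 ≤ n) : ∃ (i : ℕ) (hi : i + 2 < n),
      ∀ x, G.Adj ⟨i + 1, by omega⟩ x → x.val = i ∨ x.val = i + 2 := by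
  -- Take an edge `i j` of least span at least two. A further neighbour of `i + 1` outside the
  -- interval would give a crossing, and one inside would give a shorter span.
  have hex : ∃ d, 2 ≤ d ∧ ∃ i j : Fin n, i.val + d = j.val ∧ G.Adj i j :=
    ⟨n - 1, by omega, ⟨0, by omega⟩, ⟨n - 1, by omega⟩, by simp,
      h.adj_last _ _ rfl (by simp only; omega)⟩
  classical
  obtain ⟨hd, i, j, hij, hadj⟩ := Nat.find_spec hex
  have hmin := fun m => Nat.find_min (m := m) hex
  have hj := j.2
  refine ⟨i.val, by omega, fun x hx => ?_⟩
  have hne := hx.ne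
  rw [Ne, Fin.ext_iff] at hne
  simp only at hne
  by_contra hcon
  rcases lt_or_ge x.val i.val with h1 | h1
  · refine h.noncrossing x i ⟨i.val + 1, by omega⟩ j ?_ ?_ ?_ hx.symm hadj <;>
      simp only [Fin.lt_def] <;> omega
  · rcases lt_or_ge j.val x.val with h2 | h2
    · refine h.noncrossing i ⟨i.val + 1, by omega⟩ j x ?_ ?_ ?_ hadj hx <;>
        simp only [Fin.lt_def] <;> omega
    · exact hmin (x.val - (i.val + 1)) (by omega)
        ⟨by omega, _, x, by simp only; omega, hx⟩

theorem exists_blue_two (G : SimpleGraph (Fin 2)) (h : IsNoncrossingHamiltonian G) :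
    ∃ B : Finset (Fin 2), 2 * B.card ≤ 2 ∧ ∀ x, Blue G (B : Set (Fin 2)) x := by
  refine ⟨{0}, by simp, ?_⟩
  have h0 : Blue G (({0} : Finset (Fin 2)) : Set (Fin 2)) 0 := .init (by simp)
  intro x
  fin_cases x
  · exact h0
  · refine .force h0 (h.adj_succ 0 1 rfl) fun w hw hw1 => ?_
    fin_cases w
    · exact h0
    · exact absurd rfl hw1

/-- Five vertices `a`, `b`, `c`, `d`, `y` on a cycle `y a c d b` whose vertex `y` has degree two
and where `b`, `c` are not adjacent. -/
theorem blue_of_five {V : Type*} {G : SimpleGraph V} {y a b c d : V}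
    (hall : ∀ x, x = y ∨ x = a ∨ x = b ∨ x = c ∨ x = d)
    (hya : G.Adj y a) (hac : G.Adj a c) (hdb : G.Adj d b)
    (hyc : ¬ G.Adj y c) (hyd : ¬ G.Adj y d) (hbc : ¬ G.Adj b c) {B : Set V} (hy : y ∈ B)
    (hb : b ∈ B) : ∀ x, Blue G B x := by
  have hY : Blue G B y := .init hy
  have hB : Blue G B b := .init hb
  have hA : Blue G B a := by
    refine .force hY hya fun w hw hwa => ?_
    rcases hall w with rfl | rfl | rfl | rfl | rfl <;> first | assumption | contradiction
  have hD : Blue G B d := by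
    refine .force hB hdb.symm fun w hw hwa => ?_
    rcases hall w with rfl | rfl | rfl | rfl | rfl <;> first | assumption | contradiction
  have hC : Blue G B c := by
    refine .force hA hac fun w hw hwa => ?_
    rcases hall w with rfl | rfl | rfl | rfl | rfl <;> first | assumption | contradiction
  intro x
  rcases hall x with rfl | rfl | rfl | rfl | rfl <;> assumption

theorem exists_blue_five (G : SimpleGraph (Fin 5)) (h : IsNoncrossingHamiltonian G) :
    ∃ B : Finset (Fin 5), 2 * B.card ≤ 5 ∧ ∀ x, Blue G (B : Set (Fin 5)) x := by
  obtain ⟨i, hi, hdeg⟩ := h.exists_degree_two (by norm_num)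
  have hcard : ∀ x y : Fin 5, 2 * ({x, y} : Finset (Fin 5)).card ≤ 5 := fun x y => by
    have := Finset.card_le_two (a := x) (b := y)
    omega
  have main : ∀ y a b c d : Fin 5, (∀ x, x = y ∨ x = a ∨ x = b ∨ x = c ∨ x = d) →
      G.Adj y a → G.Adj y b → G.Adj a c → G.Adj c d → G.Adj d b → ¬ G.Adj y c → ¬ G.Adj y d →
      (G.Adj b c → G.Adj a d → False) →
      ∃ B : Finset (Fin 5), 2 * B.card ≤ 5 ∧ ∀ x, Blue G (B : Set (Fin 5)) x := by
    intro y a b c d hall hya hyb hac hcd hdb hyc hyd hno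
    -- The chords `b c` and `a d` cross, so one is absent. Reflecting the cycle in `y` exchanges the
    -- two cases.
    by_cases hbc : G.Adj b c
    · exact ⟨{y, a}, hcard _ _, blue_of_five (a := b) (b := a) (c := d) (d := c)
        (fun x => by have := hall x; tauto) hyb hdb.symm hac.symm hyd hyc (hno hbc)
        (by simp) (by simp)⟩
    · exact ⟨{y, b}, hcard _ _, blue_of_five hall hya hac hdb hyc hyd hbc (by simp) (by simp)⟩
  have h01 : G.Adj 0 1 := h.adj_succ _ _ rfl
  have h12 : G.Adj 1 2 := h.adj_succ _ _ rfl
  have h23 : G.Adj 2 3 := h.adj_succ _ _ rfl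
  have h34 : G.Adj 3 4 := h.adj_succ _ _ rfl
  have h04 : G.Adj 0 4 := h.adj_last _ _ rfl rfl
  have hi' : i = 0 ∨ i = 1 ∨ i = 2 := by omega
  rcases hi' with rfl | rfl | rfl
  · exact main 1 0 2 4 3 (by decide) h01.symm h12 h04 h34.symm h23.symm
      (fun h => by have := hdeg _ h; simp at this) (fun h => by have := hdeg _ h; simp at this)
      fun h1 h2 => h.noncrossing 0 2 3 4 (by decide) (by decide) (by decide) h2 h1
  · exact main 2 1 3 0 4 (by decide) h12.symm h23 h01.symm h04 h34.symm
      (fun h => by have := hdeg _ h; simp at this) (fun h => by have := hdeg _ h; simp at this)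
      fun h1 h2 => h.noncrossing 0 1 3 4 (by decide) (by decide) (by decide) h1.symm h2
  · exact main 3 2 4 1 0 (by decide) h23.symm h34 h12.symm h01.symm h04
      (fun h => by have := hdeg _ h; simp at this) (fun h => by have := hdeg _ h; simp at this)
      fun h1 h2 => h.noncrossing 0 1 2 4 (by decide) (by decide) (by decide) h2.symm h1.symm

theorem exists_blue {n : ℕ} {G : SimpleGraph (Fin n)} (h : IsNoncrossingHamiltonian G)
    (hn : 2 ≤ n) (hn3 : n ≠ 3) :
    ∃ B : Finset (Fin n), 2 * B.card ≤ n ∧ ∀ x, Blue G (B : Set (Fin n)) x := by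
  induction n using Nat.strong_induction_on with
  | _ n ih =>
    by_cases h2 : n = 2
    · subst h2
      exact exists_blue_two G h
    by_cases h5 : n = 5
    · subst h5
      exact exists_blue_five G h
    obtain ⟨m, rfl⟩ : ∃ m, n = m + 2 := ⟨n - 2, by omega⟩
    obtain ⟨i, hi, hdeg⟩ := h.exists_degree_two (by omega)
    obtain ⟨B', hB', hblue⟩ := ih m (by omega)
      (h.contract_isNoncrossingHamiltonian (by omega) i hi) (by omega) (by omega)
    obtain ⟨B, hB, hB2⟩ := (h.isPathContraction hi hdeg).exists_blue B'
      (isZeroForcingSet_of_blue hblue)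
    exact ⟨B, by omega, hB2⟩

end IsNoncrossingHamiltonian
end OuterplanarZF

/-! ### The outer face as a Hamilton cycle with noncrossing chords. -/

namespace OuterplanarZF

variable {V : Type*} {G : SimpleGraph V}

open Classical in
/-- The boundary modulo two of a chain of edges. -/
noncomputable def boundary [Fintype V] (z : G.edgeSet → ZMod 2) (v : V) : ZMod 2 :=
  ∑ e : G.edgeSet, if v ∈ e.1 then z e else 0

open Classical in
/-- The chain consisting of the edge of a dart. -/
noncomputable def edgeChain (d : G.Dart) (e : G.edgeSet) : ZMod 2 :=
  if d.edge = e.1 then 1 else 0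

theorem boundary_add [Fintype V] (z z' : G.edgeSet → ZMod 2) (v : V) :
    boundary (z + z') v = boundary z v + boundary z' v := by
  classical
  rw [boundary, boundary, boundary, ← Finset.sum_add_distrib]
  refine Finset.sum_congr rfl fun e _ => ?_
  split_ifs <;> simp

open Classical in
theorem boundary_edgeChain [Fintype V] (d : G.Dart) (v : V) : boundary (edgeChain d) v =
    (if v = d.fst then 1 else 0) + (if v = d.snd then 1 else 0) := by
  rw [boundary, Finset.sum_eq_single ⟨d.edge, d.edge_mem⟩]
  · have h : v ∈ d.edge ↔ v = d.fst ∨ v = d.snd := Sym2.mem_iff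
    have hne := d.fst_ne_snd
    simp only [h, edgeChain, if_true]
    by_cases h1 : v = d.fst
    · subst h1; simp [hne]
    · simp [h1]
  · intro e _ he
    have : d.edge ≠ e.1 := fun h => he (Subtype.ext h.symm)
    simp [edgeChain, this]
  · simp

open Classical in
/-- Two vertices which are connected in `G - v` are joined by a chain avoiding `v`. -/
theorem exists_chain_of_reachable [Fintype V] {v : V} (S : Set V) (hv : v ∉ S) (a b : S)
    (p : (G.induce S).Walk a b) : ∃ z : G.edgeSet → ZMod 2,
      (∀ u, boundary z u = (if u = a.1 then 1 else 0) + (if u = b.1 then 1 else 0)) ∧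
      ∀ e : G.edgeSet, v ∈ e.1 → z e = 0 := by
  induction p with
  | nil => exact ⟨0, fun u => by simp [boundary, CharTwo.add_self_eq_zero], fun _ _ => rfl⟩
  | @cons a c b hac p ih =>
    obtain ⟨z, hz, hzv⟩ := ih
    let d : G.Dart := ⟨(a.1, c.1), hac⟩
    refine ⟨edgeChain d + z, fun u => ?_, fun e he => ?_⟩
    · rw [boundary_add, hz, boundary_edgeChain]
      change _ + (if u = c.1 then (1 : ZMod 2) else 0) + ((if u = c.1 then (1 : ZMod 2) else 0) + _)
        = _
      rw [add_assoc, ← add_assoc (if u = c.1 then (1 : ZMod 2) else 0),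
        CharTwo.add_self_eq_zero, zero_add]
    · have : d.edge ≠ e.1 := by
        intro h
        rw [← h] at he
        rcases Sym2.mem_iff.1 he with h | h
        · exact hv (h ▸ a.2)
        · exact hv (h ▸ c.2)
      simp [edgeChain, this, hzv e he]

theorem edge_eq_edge_iff_of_fst_eq {d d' : G.Dart} (h : d.fst = d'.fst) :
    d.edge = d'.edge ↔ d = d' := by
  refine ⟨fun he => ?_, fun h => h ▸ rfl⟩
  rcases (SimpleGraph.dart_edge_eq_iff _ _).1 he with h' | h'
  · exact h'
  · exact absurd (h.symm.trans (by rw [h']; rfl)) d'.fst_ne_snd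

theorem edgeChain_edge {d x : G.Dart} (h : x.fst = d.fst) [Decidable (x = d)] :
    edgeChain d ⟨x.edge, x.edge_mem⟩ = if x = d then 1 else 0 := by
  classical
  by_cases hx : x = d
  · simp [edgeChain, hx]
  · rw [if_neg hx, edgeChain, if_neg]
    rwa [edge_eq_edge_iff_of_fst_eq h.symm, eq_comm]

theorem edgeChain_symm (d : G.Dart) : edgeChain d.symm = edgeChain d := by
  funext e
  rw [edgeChain, edgeChain, SimpleGraph.Dart.edge_symm]

theorem IsVertexConnected.connected (h : IsVertexConnected G 2) : G.Connected := by
  have h0 := h ∅ (by simp)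
  obtain ⟨x⟩ := h0.nonempty
  have : Nonempty V := ⟨x.1⟩
  refine ⟨fun a b => ?_⟩
  exact (h0.preconnected ⟨a, by simp⟩ ⟨b, by simp⟩).map
    (SimpleGraph.Embedding.induce _).toHom

namespace RotationSystem

variable (R : RotationSystem G)

theorem exists_face_coloring_of_boundary_eq_zero [Fintype V] (hconn : G.Connected)
    (hR : R.IsPlanar) (z : G.edgeSet → ZMod 2) (hz : ∀ v, boundary z v = 0) :
    ∃ φ : R.Face → ZMod 2, ∀ d : G.Dart,
      φ (R.faceOf (R.rot d)) = φ (R.faceOf d) + z ⟨d.edge, d.edge_mem⟩ := by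
  obtain ⟨φ, hφ⟩ := R.exists_face_coloring hconn hR z hz
  refine ⟨φ, fun d => ?_⟩
  rw [← hφ d, ← faceOf_symm, ← add_assoc, CharTwo.add_self_eq_zero, zero_add]

/-- In a 2-connected plane graph no face passes twice through a vertex. -/
theorem eq_of_faceOf_eq [Fintype V] (h2 : IsVertexConnected G 2) (hR : R.IsPlanar)
    {d d' : G.Dart} (hfst : d.fst = d'.fst) (hface : R.faceOf d = R.faceOf d') : d = d' := by
  classical
  by_contra hne
  have hv := h2 {d.fst} (by simp)
  have hd : d.snd ∈ {v | v ∉ ({d.fst} : Finset V)} := by simp [d.fst_ne_snd.symm]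
  have hd' : d'.snd ∈ {v | v ∉ ({d.fst} : Finset V)} := by simp [hfst, d'.fst_ne_snd.symm]
  obtain ⟨p⟩ := hv.preconnected ⟨_, hd⟩ ⟨_, hd'⟩
  obtain ⟨z, hz, hz0⟩ := exists_chain_of_reachable (v := d.fst) _ (by simp) _ _ p
  -- A path in `G - v` joins the far ends of `d` and `d'`, closing them to a cycle that uses no
  -- other edge at `v = d.fst`.
  obtain ⟨φ, hφ⟩ := R.exists_face_coloring_of_boundary_eq_zero h2.connected hR
    (edgeChain d + edgeChain d' + z) fun v => by
      rw [boundary_add, boundary_add, hz, boundary_edgeChain, boundary_edgeChain, ← hfst]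
      have : ∀ x y w : ZMod 2, x + y + (x + w) + (y + w) = 0 := by decide
      exact this _ _ _
  have hrot : ∀ x : G.Dart, x.fst = d.fst → φ (R.faceOf (R.rot x)) = φ (R.faceOf x) +
      ((if x = d then 1 else 0) + (if x = d' then 1 else 0)) := by
    intro x hx
    rw [hφ x, Pi.add_apply, Pi.add_apply, hz0 _ (hx ▸ Sym2.mem_mk_left _ _), add_zero]
    rw [edgeChain_edge hx, edgeChain_edge (hx.trans hfst)]
  have hex : ∃ m : ℕ, (R.rot ^ m) d = d' := by
    have : Finite G.Dart := Finite.of_injective _ SimpleGraph.Dart.toProd_injective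
    obtain ⟨m, -, hm⟩ := (R.sameCycle_of_fst_eq d d' hfst).exists_pow_eq''
    exact ⟨m, hm.2⟩
  have hm := Nat.find_spec hex
  have hmin := fun m => Nat.find_min (m := m) hex
  set m := Nat.find hex
  have hfst' : ∀ t : ℕ, ((R.rot ^ t) d).fst = d.fst := by
    intro t
    induction t with
    | zero => rfl
    | succ t ih => rw [pow_succ', Equiv.Perm.mul_apply, R.rot_fst, ih]
  -- Turning from `d`, the colour flips on crossing `d` and stays flipped until `d'` is reached, so
  -- `d` and `d'` lie on faces of different colours.
  have key : ∀ t, t < m → φ (R.faceOf ((R.rot ^ (t + 1)) d)) = φ (R.faceOf d) + 1 := by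
    intro t
    induction t with
    | zero =>
      intro _
      rw [zero_add, pow_one, hrot d rfl]
      simp [hne]
    | succ t ih =>
      intro ht
      rw [pow_succ', Equiv.Perm.mul_apply, hrot _ (hfst' _), ih (by omega),
        if_neg (hmin (t + 1) ht), if_neg, add_zero, add_zero]
      intro hcyc
      refine hmin (m - (t + 1)) (by omega) ?_
      rw [← hm]
      conv_rhs => rw [show m = (m - (t + 1)) + (t + 1) by omega, pow_add, Equiv.Perm.mul_apply,
        hcyc]
  have hm0 : m ≠ 0 := by
    intro h0
    rw [h0] at hm
    exact hne hm
  have := key (m - 1) (by omega)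
  rw [Nat.sub_add_cancel (by omega), hm, ← hface] at this
  simp at this

theorem facePerm_fst (d : G.Dart) : (R.facePerm d).fst = d.snd := R.rot_fst _

/-- The chain of the first `k` edges after step `i` of a face boundary. -/
noncomputable def faceChain (d : G.Dart) (i k : ℕ) : G.edgeSet → ZMod 2 :=
  ∑ t ∈ Finset.range k, edgeChain ((R.facePerm ^ (i + t)) d)

theorem pow_facePerm_snd (d : G.Dart) (t : ℕ) :
    ((R.facePerm ^ t) d).snd = ((R.facePerm ^ (t + 1)) d).fst := by
  rw [pow_succ', Equiv.Perm.mul_apply, facePerm_fst]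

open Classical in
theorem boundary_faceChain [Fintype V] (d : G.Dart) (i k : ℕ) (v : V) :
    boundary (R.faceChain d i k) v = (if v = ((R.facePerm ^ i) d).fst then 1 else 0) +
      (if v = ((R.facePerm ^ (i + k)) d).fst then 1 else 0) := by
  induction k with
  | zero => simp [faceChain, boundary, CharTwo.add_self_eq_zero]
  | succ k ih =>
    rw [faceChain, Finset.sum_range_succ, boundary_add, ← faceChain, ih, boundary_edgeChain,
      pow_facePerm_snd, add_assoc i k 1, add_assoc, ← add_assoc
      (if v = ((R.facePerm ^ (i + k)) d).fst then (1 : ZMod 2) else 0),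
      CharTwo.add_self_eq_zero, zero_add]

theorem faceOf_pow (d : G.Dart) (t : ℕ) : R.faceOf ((R.facePerm ^ t) d) = R.faceOf d :=
  R.faceOf_eq_iff.2 (Equiv.Perm.sameCycle_pow_left.2 (Equiv.Perm.SameCycle.refl _ _))

/-- Chords of the boundary of an outer face do not cross. -/
theorem noncrossing_of_fst_injOn [Fintype V] (hconn : G.Connected) (hR : R.IsPlanar)
    (d : G.Dart) {n : ℕ}
    (hinj : ∀ s t, s < n → t < n →
      ((R.facePerm ^ s) d).fst = ((R.facePerm ^ t) d).fst → s = t)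
    {i j k l : ℕ} (hij : i < j) (hjk : j < k) (hkl : k < l) (hl : l < n)
    (hik : G.Adj ((R.facePerm ^ i) d).fst ((R.facePerm ^ k) d).fst)
    (hjl : G.Adj ((R.facePerm ^ j) d).fst ((R.facePerm ^ l) d).fst) : False := by
  classical
  set v : ℕ → V := fun t => ((R.facePerm ^ t) d).fst
  have hmem : ∀ t u, u ∈ ((R.facePerm ^ t) d).edge → u = v t ∨ u = v (t + 1) := by
    intro t u hu
    have : u = ((R.facePerm ^ t) d).fst ∨ u = ((R.facePerm ^ t) d).snd := Sym2.mem_iff.1 hu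
    rwa [pow_facePerm_snd] at this
  let c : G.Dart := ⟨(v i, v k), hik⟩
  -- The cycle follows the outer face from `v i` to `v k` and returns along the chord.
  obtain ⟨φ, hφ⟩ := R.exists_face_coloring_of_boundary_eq_zero hconn hR
    (R.faceChain d i (k - i) + edgeChain c) fun u => by
      rw [boundary_add, boundary_faceChain, boundary_edgeChain, Nat.add_sub_cancel' (by omega)]
      exact CharTwo.add_self_eq_zero _
  have hc : ∀ (x : G.Dart) (m : ℕ), m < n → m ≠ i → m ≠ k → x.fst = v m →
      edgeChain c ⟨x.edge, x.edge_mem⟩ = 0 := by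
    intro x m hm hmi hmk hx
    refine if_neg fun he => ?_
    have : v m ∈ c.edge := by
      rw [show c.edge = x.edge from he, ← hx]
      exact Sym2.mem_mk_left _ _
    rcases Sym2.mem_iff.1 this with h | h
    · exact hmi (hinj _ _ hm (by omega) h)
    · exact hmk (hinj _ _ hm (by omega) h)
  have hzero : ∀ (x : G.Dart) (m t : ℕ), m < n → t + 1 < n → m ≠ t → m ≠ t + 1 → x.fst = v m →
      edgeChain ((R.facePerm ^ t) d) ⟨x.edge, x.edge_mem⟩ = 0 := by
    intro x m t hm ht hmt hmt' hx
    refine if_neg fun he => ?_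
    have : v m ∈ ((R.facePerm ^ t) d).edge := by
      rw [show ((R.facePerm ^ t) d).edge = x.edge from he, ← hx]
      exact Sym2.mem_mk_left _ _
    rcases hmem _ _ this with h | h
    · exact hmt (hinj _ _ hm (by omega) h)
    · exact hmt' (hinj _ _ hm (by omega) h)
  -- The cycle avoids `v l`, so every face there has the colour of the outer face.
  have hL : ∀ x y : G.Dart, x.fst = v l → y.fst = v l → φ (R.faceOf x) = φ (R.faceOf y) := by
    intro x y hx hy
    refine R.eq_of_fst_eq_of_rot (fun x => φ (R.faceOf x)) (v l) (fun x hx => ?_) hx hy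
    rw [hφ, Pi.add_apply, hc x l hl (by omega) (by omega) hx, faceChain, Finset.sum_apply,
      Finset.sum_eq_zero, add_zero, add_zero]
    intro t ht
    rw [Finset.mem_range] at ht
    exact hzero x l _ hl (by omega) (by omega) (by omega) hx
  set dj := (R.facePerm ^ j) d with hdj
  set pj := ((R.facePerm ^ (j - 1)) d).symm with hpj
  have hpj_fst : pj.fst = v j := by
    change ((R.facePerm ^ (j - 1)) d).snd = _
    rw [pow_facePerm_snd, Nat.sub_add_cancel (by omega)]
  have hrotp : R.rot pj = dj := by
    rw [hpj, ← facePerm_apply, ← Equiv.Perm.mul_apply, ← pow_succ', Nat.sub_add_cancel (by omega)]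
  have hsnd_d : dj.snd = v (j + 1) := R.pow_facePerm_snd d j
  have hJ : ∀ x : G.Dart, x.fst = v j → φ (R.faceOf (R.rot x)) =
      φ (R.faceOf x) + ((if x = pj then 1 else 0) + (if x = dj then 1 else 0)) := by
    intro x hx
    rw [hφ, Pi.add_apply, hc x j (by omega) (by omega) (by omega) hx, faceChain, Finset.sum_apply,
      add_zero, Finset.sum_eq_add (j - 1 - i) (j - i) (by omega)]
    · rw [show i + (j - 1 - i) = j - 1 by omega, show i + (j - i) = j by omega,
        ← edgeChain_symm ((R.facePerm ^ (j - 1)) d), edgeChain_edge (hx.trans hpj_fst.symm),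
        edgeChain_edge (d := (R.facePerm ^ j) d) hx]
    · intro t ht hne
      rw [Finset.mem_range] at ht
      exact hzero x j _ (by omega) (by omega) (by omega) (by omega) hx
    · intro h
      exact absurd (Finset.mem_range.2 (by omega)) h
    · intro h
      exact absurd (Finset.mem_range.2 (by omega)) h
  -- The two cycle edges at `v j` are consecutive in the rotation and enclose only the outer corner,
  -- so every other corner has the opposite colour. The face of the dart from `v j` to `v l` would
  -- then need both colours.
  have hψ : ∀ x y : G.Dart, x.fst = v j → y.fst = v j →
      φ (R.faceOf x) + (if x = dj then 1 else 0) = φ (R.faceOf y) + (if y = dj then 1 else 0) := by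
    intro x y hx hy
    refine R.eq_of_fst_eq_of_rot (fun x => φ (R.faceOf x) + (if x = dj then 1 else 0)) (v j)
      (fun x hx => ?_) hx hy
    have h1 : R.rot x = dj ↔ x = pj := by rw [← hrotp, R.rot.injective.eq_iff]
    simp only [hJ x hx, h1]
    have : ∀ a b c : ZMod 2, a + (b + c) + b = a + c := by decide
    exact this _ _ _
  let x : G.Dart := ⟨(v j, v l), hjl⟩
  -- Here `j < k < l` matters: `v l` is not the successor of `v j` on the outer face.
  have hxd : x ≠ dj := by
    intro h
    have : v l = dj.snd := congrArg (fun x : G.Dart => x.snd) h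
    rw [hsnd_d] at this
    have := hinj _ _ (by omega) (by omega) this
    omega
  have h1 := hψ x dj rfl rfl
  rw [if_neg hxd, if_pos rfl, add_zero] at h1
  have h2 : φ (R.faceOf (R.facePerm x)) = φ (R.faceOf ((R.facePerm ^ l) d)) :=
    hL _ _ (R.facePerm_fst x) rfl
  have h3 : R.faceOf (R.facePerm x) = R.faceOf x := by
    have := R.faceOf_pow x 1
    rwa [pow_one] at this
  rw [h3, h1, hdj, faceOf_pow, faceOf_pow] at h2
  simp at h2

end RotationSystem

/-- A 2-connected outerplanar graph has a Hamilton cycle without crossing chords. -/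
theorem IsOuterplanar.exists_equiv [Fintype V] (h2 : IsVertexConnected G 2)
    (h : IsOuterplanar G) : ∃ e : Fin (Fintype.card V) ≃ V,
      IsNoncrossingHamiltonian (G.comap e) := by
  classical
  obtain ⟨R, hR, f, hf⟩ := h
  obtain ⟨v₀⟩ := h2.connected.nonempty
  obtain ⟨d, -, hd⟩ := hf v₀
  replace hd : R.faceOf d = f := hd
  subst hd
  have : Fintype G.Dart := Fintype.ofInjective _ SimpleGraph.Dart.toProd_injective
  let s : Finset G.Dart := Finset.univ.filter fun x => R.faceOf x = R.faceOf d
  have hs : ∀ x, x ∈ s ↔ R.faceOf x = R.faceOf d := fun x => by simp [s]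
  have hcyc : R.facePerm.IsCycleOn (s : Set G.Dart) := by
    refine ⟨⟨fun x hx => ?_, R.facePerm.injective.injOn, fun x hx => ?_⟩, fun x hx y hy => ?_⟩
    · have := R.faceOf_pow x 1
      rw [pow_one] at this
      exact (hs _).2 (this.trans ((hs _).1 hx))
    · have := R.faceOf_pow (R.facePerm.symm x) 1
      rw [pow_one, Equiv.apply_symm_apply] at this
      exact ⟨R.facePerm.symm x, (hs _).2 (this.symm.trans ((hs _).1 hx)), by simp⟩
    · exact R.faceOf_eq_iff.1 (((hs _).1 hx).trans ((hs _).1 hy).symm)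
  have hds : d ∈ s := (hs d).2 rfl
  -- The outer walk meets every vertex by outerplanarity and none twice by 2-connectedness, so it is
  -- a Hamilton cycle.
  have hcard : s.card = Fintype.card V := by
    rw [← Finset.card_univ]
    refine Finset.card_bij (fun x _ => x.fst) (fun _ _ => Finset.mem_univ _) ?_ ?_
    · intro x hx y hy hxy
      exact R.eq_of_faceOf_eq h2 hR hxy (((hs _).1 hx).trans ((hs _).1 hy).symm)
    · intro v _
      obtain ⟨x, hx, hxf⟩ := hf v
      exact ⟨x, (hs x).2 hxf, hx⟩
  have hinj : ∀ i j, i < Fintype.card V → j < Fintype.card V →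
      ((R.facePerm ^ i) d).fst = ((R.facePerm ^ j) d).fst → i = j := by
    intro i j hi hj hij
    have := R.eq_of_faceOf_eq h2 hR hij (by rw [R.faceOf_pow, R.faceOf_pow])
    have := (hcyc.pow_apply_eq_pow_apply hds).1 this
    rw [hcard] at this
    exact this.eq_of_lt_of_lt hi hj
  have hbij : Function.Bijective
      fun i : Fin (Fintype.card V) => ((R.facePerm ^ i.val) d).fst := by
    rw [Fintype.bijective_iff_injective_and_card]
    exact ⟨fun i j hij => Fin.ext (hinj _ _ i.2 j.2 hij), Fintype.card_fin _⟩
  refine ⟨Equiv.ofBijective _ hbij, ?_, ?_, ?_⟩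
  · intro i j hij
    change G.Adj ((R.facePerm ^ i.val) d).fst ((R.facePerm ^ j.val) d).fst
    rw [← hij, ← R.pow_facePerm_snd]
    exact SimpleGraph.Dart.adj _
  · intro i j hi hj
    change G.Adj ((R.facePerm ^ i.val) d).fst ((R.facePerm ^ j.val) d).fst
    have h1 : (R.facePerm ^ Fintype.card V) d = d := by
      rw [← hcard, hcyc.pow_card_apply hds]
    have h3 := R.pow_facePerm_snd d j.val
    rw [hj, h1] at h3
    rw [hi, pow_zero, Equiv.Perm.one_apply, ← h3]
    exact (SimpleGraph.Dart.adj _).symm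
  · intro i j k l hij hjk hkl hik hjl
    exact R.noncrossing_of_fst_injOn h2.connected hR d hinj hij hjk hkl l.2 hik hjl

end OuterplanarZF

theorem theorem2 {V : Type*} [Fintype V] (G : SimpleGraph V)
    (hconn : OuterplanarZF.IsVertexConnected G 2)
    (houter : OuterplanarZF.IsOuterplanar G)
    (hcard : Fintype.card V ≠ 3) :
    (OuterplanarZF.zeroForcingNumber G : ℝ) ≤ (Fintype.card V : ℝ) / 2 := by
  obtain ⟨e, he⟩ := houter.exists_equiv hconn
  have h2 : 2 ≤ Fintype.card V := by
    obtain ⟨x⟩ := hconn.connected.nonempty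
    obtain ⟨y⟩ := (hconn {x} (by simp)).nonempty
    have hne : y.1 ≠ x := by simpa using y.2
    exact Fintype.one_lt_card_iff.2 ⟨_, _, hne⟩
  obtain ⟨B, hB, hblue⟩ := he.exists_blue h2 hcard
  have hle := OuterplanarZF.zeroForcingNumber_le (G := G) (B.map e.toEmbedding) fun x => by
    obtain ⟨i, rfl⟩ := e.surjective x
    have := (hblue i).map_equiv (G' := G) e fun _ _ => Iff.rfl
    simpa using this
  rw [Finset.card_map] at hle
  rw [le_div_iff₀ two_pos]
  have : OuterplanarZF.zeroForcingNumber G * 2 ≤ Fintype.card V := by omega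
  exact_mod_cast this
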